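/- For an at most countable index set $J$ and a family $(L_i)_{i\in J}$ of real $2\times 2$ matrices, write $L_u=L_{u_1}\cdots L_{u_m}$ for $u=(u_1,\dots,u_m)\in J^m$. For a matrix $L$ with singular values $\alpha_1(L)\ge\alpha_2(L)$ let $\varphi^r(L)=\alpha_1(L)^r$ if $0<r\le 1$, $\varphi^r(L)=\alpha_1(L)\alpha_2(L)^{r-1}$ if $1<r\le 2$, and $\varphi^r(L)=|\det L|^{r/2}$ if $r>2$. The affinity dimension is $$d(L_i\mid i\in J)=\inf\Big\{r>0:\ \sum_{m\ge 1}\sum_{u\in J^m}\varphi^r(L_u)<\infty\Big\}\in[0,\infty],\qquad \inf\emptyset=\infty .$$ Theorem. Let $I$ be a countably infinite set. For each $i\in I$ let $A_i:[0,1]^2\to[0,1]^2$ be an affine map $A_i(x)=L_ix+v_i$ with $v_i\in\mathbb R^2$ and $L_i=\begin{pmatrix}a_i&0\\0&b_i\end{pmatrix}$, $|a_i|,|b_i|\in(0,1)$, and suppose that $\sup_{i\in I}\max\{|a_i|,|b_i|\}<1$. For $J\subseteq I$ let $$F_J=\bigcup_{\omega\in J^{\mathbb N}}\ \bigcap_{n\ge1}A_{\omega_1}\circ\cdots\circ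 A_{\omega_n}([0,1]^2)$$ be the limit set of $\{A_i:i\in J\}$, and let $F=F_I$. Then the following hold. 1. $\dim_{\mathcal H}(F)\le\min\{2,\ d(L_i\mid i\in I)\}$. 2. Suppose that there is a finite set $I_1\subseteq I$ such that, for every finite set $I_2$ with $I_1\subseteq I_2\subseteq I$, the box-counting dimension of $F_{I_2}$ exists and $\dim_B(F_{I_2})=d(L_i\mid i\in I_2)$. Then $$d(L_i\mid i\in I)\ \le\ \underline{\dim}_B(F)\ \le\ \overline{\dim}_B(F)\ =\ \dim_P(F).$$ Here $\dim_{\mathcal H}$ and $\dim_P$ are the Hausdorff and packing dimensions, and $\underline{\dim}_B$, $\overline{\dim}_B$ are the lower and upper box-counting dimensions. -/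

import Mathlib

open scoped ENNReal NNReal

/-- The Euclidean plane. -/
abbrev Plane : Type := EuclideanSpace ℝ (Fin 2)

namespace AffineIFS

noncomputable section

/-! ### Limit sets -/

/-- The composition `φ_{ω 0} ∘ φ_{ω 1} ∘ ⋯ ∘ φ_{ω (n - 1)}`. -/
def prefixComp {ι X : Type*} (φ : ι → X → X) (ω : ℕ → ι) : ℕ → X → X
  | 0 => id
  | n + 1 => prefixComp φ ω n ∘ φ (ω n)

/-- The limit set of `{φ i : i ∈ ι}` acting on `K`: the points `π(ω)`, `ω ∈ ι^ℕ`, where `π(ω)` is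
the only element of `⋂ n, φ_{ω 0} ∘ ⋯ ∘ φ_{ω (n - 1)} (K)`. -/
def limitSet {ι X : Type*} (φ : ι → X → X) (K : Set X) : Set X :=
  ⋃ ω : ℕ → ι, ⋂ n : ℕ, prefixComp φ ω n '' K

/-- The unit square `[0,1]²`. -/
def unitSquare : Set Plane := {x | ∀ j, x j ∈ Set.Icc (0 : ℝ) 1}

/-- The affine map `x ↦ L x + v` of the plane. -/
def affineMap (L : Matrix (Fin 2) (Fin 2) ℝ) (v : Plane) (x : Plane) : Plane :=
  Matrix.toEuclideanLin L x + v

/-! ### Affinity dimension -/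

/-- The singular value function `φ^r` (for `r > 0`). Note that `singularValues` lists the singular
values in decreasing order starting with index `0`, so that `α_k` is its entry `k - 1`. -/
def singularValueFun {D : ℕ} (r : ℝ) (L : Matrix (Fin D) (Fin D) ℝ) : ℝ :=
  if r ≤ D then
    (∏ j ∈ Finset.range (⌈r⌉₊ - 1), (Matrix.toEuclideanLin L).singularValues j) *
      (Matrix.toEuclideanLin L).singularValues (⌈r⌉₊ - 1) ^ (r - ⌈r⌉₊ + 1)
  else |L.det| ^ (r / D)

/-- The product `L_{u 0} L_{u 1} ⋯ L_{u (m - 1)}`. -/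
def wordProd {ι : Type*} {D : ℕ} (L : ι → Matrix (Fin D) (Fin D) ℝ) {m : ℕ} (u : Fin m → ι) :
    Matrix (Fin D) (Fin D) ℝ :=
  (List.ofFn fun j => L (u j)).prod

/-- The sum of `φ^r(L_u)` over all words `u` of length at least `1`. -/
def affinitySeries {ι : Type*} {D : ℕ} (L : ι → Matrix (Fin D) (Fin D) ℝ) (r : ℝ) : ℝ≥0∞ :=
  ∑' m : ℕ, ∑' u : Fin (m + 1) → ι, ENNReal.ofReal (singularValueFun r (wordProd L u))

/-- The affinity dimension: the infimum of all `r > 0` with convergent series (`∞` if there is no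
such `r`). -/
def affinityDim {ι : Type*} {D : ℕ} (L : ι → Matrix (Fin D) (Fin D) ℝ) : ℝ≥0∞ :=
  ⨅ (r : ℝ) (_ : 0 < r) (_ : affinitySeries L r < ∞), ENNReal.ofReal r

/-! ### Box-counting dimensions -/

/-- The smallest cardinality of a cover of `F` by sets of diameter at most `δ`. -/
def boxCount {X : Type*} [PseudoMetricSpace X] (δ : ℝ) (F : Set X) : ℕ∞ :=
  ⨅ (C : Set (Set X)) (_ : F ⊆ ⋃₀ C) (_ : ∀ U ∈ C, Metric.ediam U ≤ ENNReal.ofReal δ), C.encard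

/-- The quotient `log N_δ(F) / (- log δ)`. -/
def boxRatio {X : Type*} [PseudoMetricSpace X] (F : Set X) (δ : ℝ) : EReal :=
  ENNReal.log (boxCount δ F : ℝ≥0∞) / ((-Real.log δ : ℝ) : EReal)

/-- The lower box-counting dimension. -/
def lowerBoxDim {X : Type*} [PseudoMetricSpace X] (F : Set X) : EReal :=
  Filter.liminf (boxRatio F) (nhdsWithin 0 (Set.Ioi 0))

/-- The upper box-counting dimension. -/
def upperBoxDim {X : Type*} [PseudoMetricSpace X] (F : Set X) : EReal :=
  Filter.limsup (boxRatio F) (nhdsWithin 0 (Set.Ioi 0))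

/-- The box-counting dimension of `F` exists and equals `d`. -/
def HasBoxDim {X : Type*} [PseudoMetricSpace X] (F : Set X) (d : EReal) : Prop :=
  lowerBoxDim F = d ∧ upperBoxDim F = d

/-! ### Packing dimension -/

/-- A finite collection of balls (given by centre and radius) which are pairwise disjoint, have
centre in `F` and radius in `(0, δ]`. -/
def IsBallPacking {X : Type*} [PseudoMetricSpace X] (δ : ℝ) (F : Set X)
    (t : Finset (X × ℝ)) : Prop :=
  (∀ p ∈ t, p.1 ∈ F ∧ 0 < p.2 ∧ p.2 ≤ δ) ∧
    (t : Set (X × ℝ)).PairwiseDisjoint fun p => Metric.closedBall p.1 p.2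

/-- The packing premeasure `P^s_0(F) = lim_{δ → 0} P^s_δ(F)`, where `P^s_δ(F)` is the supremum of
`∑ (2 r_i)^s` over all packings by balls of radii `r_i ≤ δ` (the supremum over countable packings is
the supremum over finite ones); the limit is an infimum as `P^s_δ(F)` is monotone in `δ`. -/
def packingPremeasure {X : Type*} [PseudoMetricSpace X] (s : ℝ) (F : Set X) : ℝ≥0∞ :=
  ⨅ (δ : ℝ) (_ : 0 < δ), ⨆ (t : Finset (X × ℝ)) (_ : IsBallPacking δ F t),
    ∑ p ∈ t, ENNReal.ofReal (2 * p.2) ^ s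

/-- The `s`-dimensional packing measure `P^s(F) = inf {∑ P^s_0(F_n) : F ⊆ ⋃ F_n}`. -/
def packingMeasure {X : Type*} [PseudoMetricSpace X] (s : ℝ) (F : Set X) : ℝ≥0∞ :=
  ⨅ (G : ℕ → Set X) (_ : F ⊆ ⋃ n, G n), ∑' n, packingPremeasure s (G n)

/-- The packing dimension `inf {s ≥ 0 : P^s(F) = 0}`. -/
def packingDim {X : Type*} [PseudoMetricSpace X] (F : Set X) : ℝ≥0∞ :=
  ⨅ (s : ℝ) (_ : 0 ≤ s) (_ : packingMeasure s F = 0), ENNReal.ofReal s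

end

end AffineIFS

namespace AffineIFS

/-! For a diagonal matrix the singular value function is the maximum of two multiplicative weights,
`diagWeight r |x| |y|` and its swap. Summed over words of length `m`, each weight gives the `m`-th
power of a one-letter sum `weightSum`. Hence the affinity series converges exactly when both
one-letter sums are less than `1` (`affinitySeries_diagonal_lt_top_iff`).

Hausdorff dimension: a cylinder is contained in a rectangle. For `r ≤ 1` it is used whole, and for
`1 < r ≤ 2` it is cut into pieces comparable to its shorter side. The cost is at most `8 *
φ^r(L_u)`, so the total cost at level `n` is bounded by a multiple of a term of a convergent series
and tends to `0` (`dimH_limitSet_le`).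

Lower box dimension: it is monotone, so it dominates the affinity dimension of every finite
subsystem containing `I₁`. A sum of nonnegative terms is the supremum of its finite partial sums,
and all entries are at most `c < 1`. These bounds therefore pass to the whole system
(`affinityDim_le_of_finite_subsystems`).

Packing dimension: the bound by the upper box dimension holds for every nonempty set. For the
converse, the limit set need not be closed, so Baire's theorem is applied to the code space `ℕ → I`.
If countably many sets of finite packing premeasure cover the limit set, the closure of one of them
contains the image of the limit set under some `prefixComp`. Passing to the closure and undoing this
map change box counts only by constants (`upperBoxDim_limitSet_le_packingDim`). -/

open Filter Topology

/-! ### Multiplicative weights -/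

/-- The exponent of the larger singular value in the singular value function of the plane. -/
noncomputable def majorExp (r : ℝ) : ℝ := min r 1 + max (r - 2) 0 / 2

/-- The exponent of the smaller singular value in the singular value function of the plane. -/
noncomputable def minorExp (r : ℝ) : ℝ := max (min r 2 - 1) 0 + max (r - 2) 0 / 2

/-- The multiplicative function `x ^ majorExp r * y ^ minorExp r`; the singular value function of
a diagonal matrix is the maximum of its two values on the absolute values of the entries. -/
noncomputable def diagWeight (r x y : ℝ) : ℝ := x ^ majorExp r * y ^ minorExp r

lemma majorExp_add_minorExp (r : ℝ) : majorExp r + minorExp r = r := by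
  unfold majorExp minorExp
  rcases le_total r 1 with h1 | h1 <;> rcases le_total r 2 with h2 | h2 <;>
    simp [min_def, max_def] <;> split_ifs <;> linarith

lemma majorExp_mono : Monotone majorExp := fun r s h => by
  unfold majorExp; gcongr

lemma minorExp_mono : Monotone minorExp := fun r s h => by
  unfold minorExp; gcongr

lemma minorExp_le_majorExp {r : ℝ} (hr : 0 ≤ r) : minorExp r ≤ majorExp r := by
  unfold majorExp minorExp
  rcases le_total r 1 with h1 | h1 <;> rcases le_total r 2 with h2 | h2 <;>
    simp [min_def, max_def] <;> split_ifs <;> linarith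

/-- After cancelling the common factor `(x * y) ^ minorExp r`, this is monotonicity of the power
with exponent `majorExp r - minorExp r ≥ 0`. -/
lemma diagWeight_le_swap {r x y : ℝ} (hr : 0 ≤ r) (hx : 0 < x) (hxy : x ≤ y) :
    diagWeight r x y ≤ diagWeight r y x := by
  have hy := hx.trans_le hxy
  unfold diagWeight
  have e : ∀ z : ℝ, 0 < z → z ^ majorExp r = z ^ (majorExp r - minorExp r) * z ^ minorExp r :=
    fun z hz => by rw [← Real.rpow_add hz]; ring_nf
  have := Real.rpow_le_rpow hx.le hxy (sub_nonneg.2 (minorExp_le_majorExp hr))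
  rw [e x hx, e y hy]
  have h1 : 0 < x ^ minorExp r := by positivity
  have h2 : 0 < y ^ minorExp r := by positivity
  nlinarith [mul_le_mul_of_nonneg_right this (mul_pos h1 h2).le]

lemma diagWeight_prod {ι : Type*} (s : Finset ι) (r : ℝ) {f g : ι → ℝ} (hf : ∀ i, 0 ≤ f i)
    (hg : ∀ i, 0 ≤ g i) :
    diagWeight r (∏ i ∈ s, f i) (∏ i ∈ s, g i) = ∏ i ∈ s, diagWeight r (f i) (g i) := by
  unfold diagWeight
  rw [← Real.finsetProd_rpow _ _ (fun i _ => hf i), ← Real.finsetProd_rpow _ _ (fun i _ => hg i),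
    Finset.prod_mul_distrib]

/-- Both exponents are nondecreasing in `r` and they add up to `r`, so the gains in the two factors
combine to exactly `c ^ (s - r)`. -/
lemma diagWeight_le_mul_rpow {r s x y c : ℝ} (hrs : r ≤ s) (hx : 0 < x) (hy : 0 < y) (hxc : x ≤ c)
    (hyc : y ≤ c) : diagWeight s x y ≤ c ^ (s - r) * diagWeight r x y := by
  have hc := hx.trans_le hxc
  have e : ∀ z p q : ℝ, 0 < z → z ≤ c → p ≤ q → z ^ q ≤ c ^ (q - p) * z ^ p := by
    intro z p q hz hzc hpq
    calc z ^ q = z ^ (q - p) * z ^ p := by rw [← Real.rpow_add hz]; ring_nf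
      _ ≤ _ := by gcongr
  calc diagWeight s x y ≤ (c ^ (majorExp s - majorExp r) * x ^ majorExp r) *
        (c ^ (minorExp s - minorExp r) * y ^ minorExp r) := by
        unfold diagWeight
        gcongr
        · exact e _ _ _ hx hxc (majorExp_mono hrs)
        · exact e _ _ _ hy hyc (minorExp_mono hrs)
    _ = c ^ ((majorExp s + minorExp s) - (majorExp r + minorExp r)) * diagWeight r x y := by
        unfold diagWeight
        rw [show (majorExp s + minorExp s) - (majorExp r + minorExp r) =
          (majorExp s - majorExp r) + (minorExp s - minorExp r) by ring, Real.rpow_add hc]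
        ring
    _ = _ := by rw [majorExp_add_minorExp, majorExp_add_minorExp]

/-! ### Singular values of diagonal matrices -/

lemma toEuclideanLin_diagonal_apply (x y : ℝ) (w : Plane) (j : Fin 2) :
    Matrix.toEuclideanLin (Matrix.diagonal ![x, y]) w j = ![x, y] j * w j := by
  fin_cases j <;> simp [Matrix.toLpLin_apply]

/-- The squared singular values are eigenvalues of `diag(x², y²)`, hence lie in `{x², y²}`. The
trace excludes that one value is taken twice while the other is missed, and the decreasing order
tells which comes first. -/
lemma singularValues_diagonal (x y : ℝ) :
    (Matrix.toEuclideanLin (Matrix.diagonal ![x, y])).singularValues 0 = max |x| |y| ∧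
    (Matrix.toEuclideanLin (Matrix.diagonal ![x, y])).singularValues 1 = min |x| |y| := by
  set T := Matrix.toEuclideanLin (Matrix.diagonal ![x, y]) with hT
  have hadj : LinearMap.adjoint T ∘ₗ T = Matrix.toEuclideanLin (Matrix.diagonal ![x ^ 2, y ^ 2]) := by
    rw [hT, ← Matrix.toEuclideanLin_conjTranspose_eq_adjoint, Matrix.diagonal_conjTranspose]
    ext w j
    fin_cases j <;> simp [Matrix.toLpLin_apply] <;> ring
  have hfr : Module.finrank ℝ Plane = 2 := by simp
  have hev : ∀ n < 2, T.singularValues n ^ 2 = x ^ 2 ∨ T.singularValues n ^ 2 = y ^ 2 := by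
    intro n hn
    have h := T.hasEigenvalue_adjoint_comp_self_sq_singularValues (n := n) (by simpa using hn)
    obtain ⟨w, hw⟩ := h.exists_hasEigenvector
    have h1 := hw.apply_eq_smul
    rw [hadj] at h1
    by_contra! hne
    apply hw.2
    ext j
    have h2 := congrArg (fun z : Plane => z j) h1
    simp only [toEuclideanLin_diagonal_apply, PiLp.smul_apply, smul_eq_mul] at h2
    have h3 : (![x ^ 2, y ^ 2] j - T.singularValues n ^ 2) * w j = 0 := by linear_combination h2
    rcases mul_eq_zero.1 h3 with h4 | h4
    · exfalso
      fin_cases j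
      · exact hne.1 (by simpa using (sub_eq_zero.1 h4).symm)
      · exact hne.2 (by simpa using (sub_eq_zero.1 h4).symm)
    · simpa using h4
  have htr : T.singularValues 0 ^ 2 + T.singularValues 1 ^ 2 = x ^ 2 + y ^ 2 := by
    have h := T.isSymmetric_adjoint_comp_self.trace_eq_sum_eigenvalues hfr
    have h' : LinearMap.trace ℝ Plane (LinearMap.adjoint T ∘ₗ T) = x ^ 2 + y ^ 2 := by
      rw [hadj, Matrix.toEuclideanLin, Matrix.toLpLin_eq_toLin, Matrix.trace_toLin_eq, Matrix.trace_diagonal]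
      simp
    rw [h', Fin.sum_univ_two] at h
    rw [T.sq_singularValues_of_lt hfr (by norm_num : 0 < 2),
      T.sq_singularValues_of_lt hfr (by norm_num : 1 < 2)]
    simpa using h.symm
  have h0 := T.singularValues_nonneg 0
  have h1 := T.singularValues_nonneg 1
  have hle : T.singularValues 1 ≤ T.singularValues 0 := T.singularValues_antitone zero_le_one
  have key : ∀ s t : ℝ, 0 ≤ s → s ^ 2 = t ^ 2 → s = |t| := fun s t hs h => by
    rw [← abs_of_nonneg hs]; exact (sq_eq_sq_iff_abs_eq_abs _ _).1 h
  rcases hev 0 (by norm_num) with h | h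
  · have e0 := key _ _ h0 h
    have e1 := key _ _ h1 (show T.singularValues 1 ^ 2 = y ^ 2 by linarith)
    rw [e0, e1] at hle ⊢
    simp [hle]
  · have e0 := key _ _ h0 h
    have e1 := key _ _ h1 (show T.singularValues 1 ^ 2 = x ^ 2 by linarith)
    rw [e0, e1] at hle ⊢
    simp [hle]

lemma singularValueFun_diagonal {r x y : ℝ} (hr : 0 < r) (hx : x ≠ 0) (hy : y ≠ 0) :
    singularValueFun r (Matrix.diagonal ![x, y]) =
      max (diagWeight r |x| |y|) (diagWeight r |y| |x|) := by
  have hx' := abs_pos.2 hx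
  have hy' := abs_pos.2 hy
  have main : singularValueFun r (Matrix.diagonal ![x, y]) =
      diagWeight r (max |x| |y|) (min |x| |y|) := by
    obtain ⟨s0, s1⟩ := singularValues_diagonal x y
    unfold singularValueFun diagWeight majorExp minorExp
    rcases le_or_gt r 1 with h1 | h1
    · have hc : ⌈r⌉₊ = 1 := by rw [Nat.ceil_eq_iff (by norm_num)]; norm_num; exact ⟨hr, h1⟩
      rw [if_pos (by push_cast; linarith), hc]
      simp [s0, min_eq_left h1, min_eq_left (show r ≤ 2 by linarith),
        max_eq_right (show r - 2 ≤ 0 by linarith), max_eq_right (show r - 1 ≤ 0 by linarith)]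
    rcases le_or_gt r 2 with h2 | h2
    · have hc : ⌈r⌉₊ = 2 := by rw [Nat.ceil_eq_iff (by norm_num)]; norm_num; exact ⟨h1, h2⟩
      rw [if_pos (by push_cast; linarith), hc]
      simp [s0, s1, min_eq_right h1.le, min_eq_left h2,
        max_eq_right (show r - 2 ≤ 0 by linarith), max_eq_left (show 0 ≤ r - 1 by linarith)]
      left; congr 1; ring
    · rw [if_neg (by push_cast; linarith), min_eq_right h1.le, min_eq_right h2.le,
        max_eq_left (show (0:ℝ) ≤ r - 2 by linarith), max_eq_left (by norm_num : (0:ℝ) ≤ 2 - 1),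
        show (2 - 1 + (r - 2) / 2 : ℝ) = r / 2 by ring, show (1 + (r - 2) / 2 : ℝ) = r / 2 by ring,
        ← Real.mul_rpow (by positivity) (by positivity), max_mul_min]
      simp [Matrix.det_diagonal, abs_mul]
  rw [main]
  rcases le_total |x| |y| with h | h
  · rw [max_eq_right h, min_eq_left h, max_eq_right (diagWeight_le_swap hr.le hx' h)]
  · rw [max_eq_left h, min_eq_right h, max_eq_left (diagWeight_le_swap hr.le hy' h)]

/-! ### The affinity series of a diagonal system -/

lemma ENNReal_tsum_pi_prod {ι : Type*} (f : ι → ℝ≥0∞) (m : ℕ) :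
    ∑' u : Fin m → ι, ∏ j, f (u j) = (∑' i, f i) ^ m := by
  induction m with
  | zero => simp
  | succ m ih =>
    rw [← (Fin.consEquiv fun _ : Fin (m + 1) => ι).tsum_eq, ENNReal.tsum_prod']
    simp [Fin.consEquiv, Fin.prod_univ_succ, ENNReal.tsum_mul_left, ENNReal.tsum_mul_right, ih,
      pow_succ']

lemma wordProd_diagonal {ι : Type*} (a b : ι → ℝ) {m : ℕ} (u : Fin m → ι) :
    wordProd (fun i => Matrix.diagonal ![a i, b i]) u =
      Matrix.diagonal ![∏ j, a (u j), ∏ j, b (u j)] := by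
  unfold wordProd
  induction m with
  | zero =>
    simp only [List.ofFn_zero, List.prod_nil, Finset.univ_eq_empty, Finset.prod_empty]
    rw [← Matrix.diagonal_one]
    congr 1
    ext j; fin_cases j <;> rfl
  | succ m ih =>
    rw [List.ofFn_succ, List.prod_cons, ih (fun j => u j.succ), Matrix.diagonal_mul_diagonal,
      Fin.prod_univ_succ, Fin.prod_univ_succ]
    congr 1
    ext j; fin_cases j <;> rfl

/-- The sum of `diagWeight r` over a system of diagonal matrices. -/
noncomputable def weightSum {ι : Type*} (r : ℝ) (a b : ι → ℝ) : ℝ≥0∞ :=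
  ∑' i, ENNReal.ofReal (diagWeight r |a i| |b i|)

lemma tsum_diagWeight_words {ι : Type*} (r : ℝ) (a b : ι → ℝ) (m : ℕ) :
    ∑' u : Fin m → ι, ENNReal.ofReal (diagWeight r |∏ j, a (u j)| |∏ j, b (u j)|) =
      weightSum r a b ^ m := by
  rw [weightSum, ← ENNReal_tsum_pi_prod]
  refine tsum_congr fun u => ?_
  rw [Finset.abs_prod, Finset.abs_prod,
    diagWeight_prod _ _ (fun _ => abs_nonneg _) (fun _ => abs_nonneg _),
    ENNReal.ofReal_prod_of_nonneg]
  intro j _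
  unfold diagWeight; positivity

/-- The maximum of the two weights lies between each of them and their sum, so the series is finite
exactly when two geometric series are. -/
lemma affinitySeries_diagonal_lt_top_iff {ι : Type*} {a b : ι → ℝ} (ha : ∀ i, a i ≠ 0)
    (hb : ∀ i, b i ≠ 0) {r : ℝ} (hr : 0 < r) :
    affinitySeries (fun i => Matrix.diagonal ![a i, b i]) r < ∞ ↔
      weightSum r a b < 1 ∧ weightSum r b a < 1 := by
  have e : ∀ {m : ℕ} (u : Fin m → ι),
      ENNReal.ofReal (singularValueFun r (wordProd (fun i => Matrix.diagonal ![a i, b i]) u)) =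
      max (ENNReal.ofReal (diagWeight r |∏ j, a (u j)| |∏ j, b (u j)|))
        (ENNReal.ofReal (diagWeight r |∏ j, b (u j)| |∏ j, a (u j)|)) := fun u => by
    rw [wordProd_diagonal, singularValueFun_diagonal hr (Finset.prod_ne_zero_iff.2 fun _ _ => ha _)
      (Finset.prod_ne_zero_iff.2 fun _ _ => hb _), ENNReal.ofReal_max]
  have geom : ∀ x : ℝ≥0∞, ∑' m : ℕ, x ^ (m + 1) < ∞ ↔ x < 1 := by
    intro x
    rw [ENNReal.tsum_geometric_add_one]
    constructor
    · intro h
      by_contra! hx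
      -- For `x ≥ 1` truncated subtraction gives `1 - x = 0`, so the closed form `x * (1 - x)⁻¹` is
      -- `∞`.
      rw [tsub_eq_zero_of_le hx, ENNReal.inv_zero, ENNReal.mul_top (by positivity)] at h
      exact lt_irrefl _ h
    · intro h
      exact ENNReal.mul_lt_top (h.trans ENNReal.one_lt_top)
        (ENNReal.inv_lt_top.2 (tsub_pos_of_lt h))
  rw [← geom, ← geom]
  unfold affinitySeries
  simp only [e, ← tsum_diagWeight_words]
  constructor
  · intro h
    constructor
    · exact lt_of_le_of_lt (ENNReal.tsum_le_tsum fun m => ENNReal.tsum_le_tsum fun u =>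
        le_max_left _ _) h
    · exact lt_of_le_of_lt (ENNReal.tsum_le_tsum fun m => ENNReal.tsum_le_tsum fun u =>
        le_max_right _ _) h
  · rintro ⟨h1, h2⟩
    refine lt_of_le_of_lt ?_ (ENNReal.add_lt_top.2 ⟨h1, h2⟩)
    rw [← ENNReal.tsum_add]
    refine ENNReal.tsum_le_tsum fun m => ?_
    rw [← ENNReal.tsum_add]
    exact ENNReal.tsum_le_tsum fun u => max_le_add_of_nonneg zero_le zero_le

lemma weightSum_le_mul {ι : Type*} {a b : ι → ℝ} (ha : ∀ i, a i ≠ 0) (hb : ∀ i, b i ≠ 0) {c : ℝ}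
    (hac : ∀ i, |a i| ≤ c) (hbc : ∀ i, |b i| ≤ c) {r s : ℝ} (hrs : r ≤ s) :
    weightSum s a b ≤ ENNReal.ofReal (c ^ (s - r)) * weightSum r a b := by
  unfold weightSum
  rw [← ENNReal.tsum_mul_left]
  refine ENNReal.tsum_le_tsum fun i => ?_
  have hc := (abs_nonneg _).trans (hac i)
  rw [← ENNReal.ofReal_mul (by positivity)]
  exact ENNReal.ofReal_le_ofReal
    (diagWeight_le_mul_rpow hrs (abs_pos.2 (ha i)) (abs_pos.2 (hb i)) (hac i) (hbc i))

lemma weightSum_antitone {ι : Type*} {a b : ι → ℝ} (ha : ∀ i, a i ≠ 0) (hb : ∀ i, b i ≠ 0)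
    (hac : ∀ i, |a i| ≤ 1) (hbc : ∀ i, |b i| ≤ 1) : Antitone fun r => weightSum r a b :=
  fun r s hrs => by simpa using weightSum_le_mul ha hb hac hbc hrs

/-- If the affinity dimensions of the finite subsystems containing a given one are at most `t`, then
the affinity dimension of the whole system is at most `t`. -/
lemma affinityDim_le_of_finite_subsystems {ι : Type*} {a b : ι → ℝ} (ha : ∀ i, a i ≠ 0)
    (hb : ∀ i, b i ≠ 0) {c : ℝ} (hc0 : 0 < c) (hc : c < 1) (hac : ∀ i, |a i| ≤ c)
    (hbc : ∀ i, |b i| ≤ c) (I₁ : Finset ι) {t : ℝ≥0∞}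
    (h : ∀ I₂ : Finset ι, I₁ ⊆ I₂ →
      affinityDim (fun i : I₂ => Matrix.diagonal ![a i, b i]) ≤ t) :
    affinityDim (fun i => Matrix.diagonal ![a i, b i]) ≤ t := by
  classical
  refine le_of_forall_gt_imp_ge_of_dense fun s hs => ?_
  -- Two exponents `t < p < q < s` are needed: the strict bounds of the finite subsystems at `p`
  -- become only `≤ 1` in the supremum, and the factor `c ^ (q - p)` restores strictness at `q`.
  obtain ⟨q, htq, hqs⟩ := ENNReal.lt_iff_exists_nnreal_btwn.1 hs
  obtain ⟨p, htp, hpq⟩ := ENNReal.lt_iff_exists_nnreal_btwn.1 htq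
  have hpq' : (p : ℝ) < q := by exact_mod_cast hpq
  have hq0 : (0 : ℝ) < q := lt_of_le_of_lt p.2 hpq'
  have fin_lt : ∀ J : Finset ι, I₁ ⊆ J →
      weightSum p (fun i : J => a i) (fun i : J => b i) ≤ 1 ∧
      weightSum p (fun i : J => b i) (fun i : J => a i) ≤ 1 := by
    intro J hJ
    have hlt := (h J hJ).trans_lt htp
    simp only [affinityDim, iInf_lt_iff] at hlt
    obtain ⟨r, hr0, hr, hrp⟩ := hlt
    have hrp' : r ≤ p := by
      rw [← ENNReal.ofReal_coe_nnreal] at hrp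
      exact (ENNReal.ofReal_lt_ofReal_iff_of_nonneg hr0.le).1 hrp |>.le
    obtain ⟨h1, h2⟩ := (affinitySeries_diagonal_lt_top_iff (fun i : J => ha i) (fun i : J => hb i)
      hr0).1 hr
    exact ⟨(weightSum_antitone (fun i : J => ha i) (fun i : J => hb i)
        (fun i => (hac i).trans hc.le) (fun i => (hbc i).trans hc.le) hrp').trans h1.le,
      (weightSum_antitone (fun i : J => hb i) (fun i : J => ha i)
        (fun i => (hbc i).trans hc.le) (fun i => (hac i).trans hc.le) hrp').trans h2.le⟩
  have whole : ∀ a b : ι → ℝ, (∀ J : Finset ι, I₁ ⊆ J →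
      weightSum p (fun i : J => a i) (fun i : J => b i) ≤ 1) → weightSum p a b ≤ 1 := by
    intro a b hab
    rw [weightSum, ENNReal.tsum_eq_iSup_sum]
    refine iSup_le fun J => ?_
    refine (Finset.sum_le_sum_of_subset (Finset.subset_union_right (s₁ := I₁))).trans ?_
    refine le_trans (le_of_eq ?_) (hab (I₁ ∪ J) Finset.subset_union_left)
    rw [weightSum, tsum_fintype]
    exact (Finset.sum_coe_sort (I₁ ∪ J) fun i => ENNReal.ofReal (diagWeight p |a i| |b i|)).symm
  have step : ∀ a b : ι → ℝ, (∀ i, a i ≠ 0) → (∀ i, b i ≠ 0) → (∀ i, |a i| ≤ c) →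
      (∀ i, |b i| ≤ c) → weightSum p a b ≤ 1 → weightSum q a b < 1 := by
    intro a b ha hb hac hbc h1
    calc weightSum q a b ≤ ENNReal.ofReal (c ^ ((q : ℝ) - p)) * weightSum p a b :=
          weightSum_le_mul ha hb hac hbc hpq'.le
      _ ≤ ENNReal.ofReal (c ^ ((q : ℝ) - p)) * 1 := by gcongr
      _ < 1 := by
          rw [mul_one, ENNReal.ofReal_lt_one]
          exact Real.rpow_lt_one hc0.le hc (sub_pos.2 hpq')
  have hfin := (affinitySeries_diagonal_lt_top_iff ha hb hq0).2
    ⟨step a b ha hb hac hbc (whole a b fun J hJ => (fin_lt J hJ).1),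
      step b a hb ha hbc hac (whole b a fun J hJ => (fin_lt J hJ).2)⟩
  refine le_trans ?_ hqs.le
  rw [← ENNReal.ofReal_coe_nnreal]
  exact iInf_le_of_le _ (iInf_le_of_le hq0 (iInf_le _ hfin))

/-! ### Cylinder sets -/

lemma prefixComp_congr {ι X : Type*} (φ : ι → X → X) {ω τ : ℕ → ι} {n : ℕ}
    (h : ∀ j < n, ω j = τ j) : prefixComp φ ω n = prefixComp φ τ n := by
  induction n with
  | zero => rfl
  | succ n ih =>
    simp only [prefixComp]
    rw [ih fun j hj => h j (hj.trans n.lt_succ_self), h n n.lt_succ_self]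

lemma prefixComp_add {ι X : Type*} (φ : ι → X → X) (ω : ℕ → ι) (n m : ℕ) :
    prefixComp φ ω (n + m) = prefixComp φ ω n ∘ prefixComp φ (fun j => ω (n + j)) m := by
  induction m with
  | zero => rfl
  | succ m ih =>
    rw [← Nat.add_assoc]
    simp only [prefixComp, ih, Function.comp_assoc]

lemma prefixComp_comp {ι κ X : Type*} (φ : ι → X → X) (f : κ → ι) (ω : ℕ → κ) (n : ℕ) :
    prefixComp (fun k => φ (f k)) ω n = prefixComp φ (f ∘ ω) n := by
  induction n with
  | zero => rfl
  | succ n ih => simp only [prefixComp, ih, Function.comp_apply]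

lemma limitSet_comp_subset {ι κ X : Type*} (φ : ι → X → X) (f : κ → ι) (K : Set X) :
    limitSet (fun k => φ (f k)) K ⊆ limitSet φ K := by
  intro x hx
  obtain ⟨ω, hω⟩ := Set.mem_iUnion.1 hx
  refine Set.mem_iUnion.2 ⟨f ∘ ω, ?_⟩
  simpa only [prefixComp_comp] using hω

lemma antitone_prefixComp_image {ι X : Type*} {φ : ι → X → X} {K : Set X}
    (h : ∀ i, Set.MapsTo (φ i) K K) (ω : ℕ → ι) : Antitone fun n => prefixComp φ ω n '' K :=
  antitone_nat_of_succ_le fun n => by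
    simp only [prefixComp, Set.image_comp]
    exact Set.image_mono (h _).image_subset

lemma continuous_affineMap (L : Matrix (Fin 2) (Fin 2) ℝ) (v : Plane) :
    Continuous (affineMap L v) :=
  (LinearMap.continuous_of_finiteDimensional _).add continuous_const

/-- The difference of the images of two points under a composition of diagonal maps. -/
lemma prefixComp_diagonal_sub {ι : Type*} {c : ι → Fin 2 → ℝ} {v : ι → Plane} (ω : ℕ → ι) (n : ℕ)
    (x y : Plane) (j : Fin 2) :
    prefixComp (fun i => affineMap (Matrix.diagonal (c i)) (v i)) ω n x j -
      prefixComp (fun i => affineMap (Matrix.diagonal (c i)) (v i)) ω n y j =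
      (∏ k ∈ Finset.range n, c (ω k) j) * (x j - y j) := by
  induction n generalizing x y with
  | zero => simp [prefixComp]
  | succ n ih =>
    simp only [prefixComp, Function.comp_apply]
    rw [ih, Finset.prod_range_succ]
    simp only [affineMap, PiLp.add_apply, Matrix.toLpLin_apply, Matrix.mulVec_diagonal]
    ring

lemma edist_le_of_coord {x y : Plane} {h : ℝ} (hh : ∀ j, |x j - y j| ≤ h) :
    edist x y ≤ ENNReal.ofReal (2 * h) := by
  have h0 := (abs_nonneg _).trans (hh 0)
  rw [edist_dist]
  refine ENNReal.ofReal_le_ofReal ?_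
  rw [EuclideanSpace.dist_eq, Fin.sum_univ_two]
  refine Real.sqrt_le_iff.2 ⟨by positivity, ?_⟩
  have e0 := pow_le_pow_left₀ (abs_nonneg _) (hh 0) 2
  have e1 := pow_le_pow_left₀ (abs_nonneg _) (hh 1) 2
  simp only [Real.dist_eq]
  nlinarith

lemma ediam_image_le {S : Set Plane} {f : Plane → Plane} {h : ℝ}
    (hf : ∀ x ∈ S, ∀ y ∈ S, ∀ j, |f x j - f y j| ≤ h) :
    Metric.ediam (f '' S) ≤ ENNReal.ofReal (2 * h) := by
  refine Metric.ediam_le ?_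
  rintro _ ⟨x, hx, rfl⟩ _ ⟨y, hy, rfl⟩
  exact edist_le_of_coord (hf x hx y hy)

lemma isCompact_unitSquare : IsCompact unitSquare := by
  have : unitSquare = (EuclideanSpace.equiv (Fin 2) ℝ) ⁻¹'
      (Set.univ.pi fun _ => Set.Icc (0 : ℝ) 1) := by
    ext x; simp only [unitSquare, Set.mem_preimage, Set.mem_univ_pi, Set.mem_ofPred_eq]; rfl
  rw [this]
  exact ((EuclideanSpace.equiv (Fin 2) ℝ).toHomeomorph.isCompact_preimage).2
    (isCompact_univ_pi fun _ => isCompact_Icc)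

lemma unitSquare_nonempty : unitSquare.Nonempty := ⟨0, fun j => by simp⟩

lemma abs_sub_le_one_of_mem_unitSquare {x y : Plane} (hx : x ∈ unitSquare) (hy : y ∈ unitSquare)
    (j : Fin 2) : |x j - y j| ≤ 1 := by
  have h1 := hx j; have h2 := hy j
  rw [Set.mem_Icc] at h1 h2
  rw [abs_le]; constructor <;> linarith

/-! ### Covers of cylinders and Hausdorff dimension -/

/-- A rectangle is covered by about `α / β` squares, where `α ≥ β` are its side lengths. -/
lemma exists_slices {f : Plane → Plane} {c : Fin 2 → ℝ}
    (hf : ∀ x y j, |f x j - f y j| = c j * |x j - y j|) {k l : Fin 2} (hkl : k ≠ l)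
    (hl : 0 < c l) (hle : c l ≤ c k) :
    ∃ (K : ℕ) (t : Fin K → Set Plane), f '' unitSquare ⊆ ⋃ i, t i ∧
      (∀ i, Metric.ediam (t i) ≤ ENNReal.ofReal (2 * c l)) ∧ K * c l ≤ 2 * c k := by
  have hk := hl.trans_le hle
  have hq : 0 < c k / c l := by positivity
  have hK0 : 0 < ⌈c k / c l⌉₊ := Nat.ceil_pos.2 hq
  have hKR : (0 : ℝ) < ⌈c k / c l⌉₊ := by exact_mod_cast hK0
  -- The square is cut across direction `k` into `⌈c k / c l⌉₊` strips, enough for the image of each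
  -- to have width at most `c l`.
  refine ⟨⌈c k / c l⌉₊, fun i => f '' {x ∈ unitSquare | (i : ℝ) ≤ ⌈c k / c l⌉₊ * x k ∧
    ⌈c k / c l⌉₊ * x k ≤ (i : ℝ) + 1}, ?_, ?_, ?_⟩
  · rintro _ ⟨x, hx, rfl⟩
    rw [Set.mem_iUnion]
    have hxk := hx k
    rw [Set.mem_Icc] at hxk
    have hnn : 0 ≤ ⌈c k / c l⌉₊ * x k := mul_nonneg hKR.le hxk.1
    rcases hxk.2.eq_or_lt with h1 | h1
    -- On the edge `x k = 1` the floor would be one too large; such points belong to the last strip.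
    · refine ⟨⟨⌈c k / c l⌉₊ - 1, by omega⟩, x, ⟨hx, ?_⟩, rfl⟩
      rw [h1]
      have : ((⌈c k / c l⌉₊ - 1 : ℕ) : ℝ) + 1 = ⌈c k / c l⌉₊ := by
        exact_mod_cast Nat.sub_add_cancel hK0
      constructor <;> simp only [] <;> linarith
    · refine ⟨⟨⌊⌈c k / c l⌉₊ * x k⌋₊, ?_⟩, x, ⟨hx, Nat.floor_le hnn, (Nat.lt_floor_add_one _).le⟩,
        rfl⟩
      rw [Nat.floor_lt hnn]
      nlinarith
  · intro i
    refine ediam_image_le fun x hx y hy j => ?_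
    rw [hf]
    have hj : j = k ∨ j = l := by omega
    rcases hj with rfl | rfl
    · have h1 : ⌈c j / c l⌉₊ * |x j - y j| ≤ 1 := by
        rw [← abs_of_pos hKR, ← abs_mul, abs_le]
        constructor <;> nlinarith [hx.2.1, hx.2.2, hy.2.1, hy.2.2]
      have h2 : c j ≤ ⌈c j / c l⌉₊ * c l := by
        have := Nat.le_ceil (c j / c l)
        rwa [div_le_iff₀ hl] at this
      calc c j * |x j - y j| ≤ (⌈c j / c l⌉₊ * c l) * |x j - y j| := by gcongr
        _ = c l * (⌈c j / c l⌉₊ * |x j - y j|) := by ring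
        _ ≤ c l * 1 := by gcongr
        _ = c l := mul_one _
    · exact mul_le_of_le_one_right hl.le (abs_sub_le_one_of_mem_unitSquare hx.1 hy.1 j)
  · have h1 := Nat.ceil_lt_add_one hq.le
    have h2 : (1 : ℝ) ≤ c k / c l := by rwa [one_le_div hl]
    calc (⌈c k / c l⌉₊ : ℝ) * c l ≤ (2 * (c k / c l)) * c l := by gcongr; linarith
      _ = 2 * c k := by field_simp

/-- The image of the unit square under a diagonal map has a cover whose `r`-dimensional cost is at
most a constant times the singular value function. -/
lemma exists_cover_cost_le {f : Plane → Plane} {c : Fin 2 → ℝ}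
    (hf : ∀ x y j, |f x j - f y j| = c j * |x j - y j|) (hc : ∀ j, 0 < c j) {r : ℝ} (hr : 0 < r)
    (hr2 : r ≤ 2) {k l : Fin 2} (hkl : k ≠ l) (hle : c l ≤ c k) :
    ∃ (K : ℕ) (t : Fin K → Set Plane), f '' unitSquare ⊆ ⋃ i, t i ∧
      (∀ i, Metric.ediam (t i) ≤ ENNReal.ofReal (2 * c k)) ∧
      ∑ i, Metric.ediam (t i) ^ r ≤ ENNReal.ofReal (8 * diagWeight r (c k) (c l)) := by
  have h4 : (2 : ℝ) ^ r ≤ 4 := by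
    calc (2 : ℝ) ^ r ≤ 2 ^ (2 : ℝ) := Real.rpow_le_rpow_of_exponent_le (by norm_num) hr2
      _ = 4 := by norm_num
  have hk := hc k
  have hl := hc l
  rcases le_or_gt r 1 with h1 | h1
  · refine ⟨1, fun _ => f '' unitSquare, Set.subset_iUnion_of_subset 0 subset_rfl, ?_, ?_⟩
    all_goals
      have hd : Metric.ediam (f '' unitSquare) ≤ ENNReal.ofReal (2 * c k) := by
        refine ediam_image_le fun x hx y hy j => ?_
        rw [hf]
        have hj : j = k ∨ j = l := by omega
        have := abs_sub_le_one_of_mem_unitSquare hx hy j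
        rcases hj with rfl | rfl <;> nlinarith [abs_nonneg (x j - y j)]
    · exact fun _ => hd
    · simp only [Finset.univ_unique, Finset.sum_const, Finset.card_singleton, one_smul]
      refine (ENNReal.rpow_le_rpow hd hr.le).trans ?_
      rw [ENNReal.ofReal_rpow_of_pos (by positivity), Real.mul_rpow (by norm_num) hk.le]
      refine ENNReal.ofReal_le_ofReal ?_
      have : diagWeight r (c k) (c l) = c k ^ r := by
        simp [diagWeight, majorExp, minorExp, h1, show r ≤ 2 by linarith]
      rw [this]
      gcongr
      linarith
  · obtain ⟨K, t, ht, hd, hK⟩ := exists_slices hf hkl hl hle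
    refine ⟨K, t, ht, fun i => (hd i).trans (ENNReal.ofReal_le_ofReal (by linarith)), ?_⟩
    -- The constant `8` arises here: `2 ^ r ≤ 4`, and the number of slices satisfies `K * c l ≤ 2 *
    -- c k`.
    calc ∑ i, Metric.ediam (t i) ^ r ≤ ∑ i : Fin K, ENNReal.ofReal (2 * c l) ^ r :=
          Finset.sum_le_sum fun i _ => ENNReal.rpow_le_rpow (hd i) hr.le
      _ = ENNReal.ofReal (K * (2 * c l) ^ r) := by
          rw [ENNReal.ofReal_rpow_of_pos (by positivity), ENNReal.ofReal_mul (by positivity)]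
          simp
      _ ≤ _ := by
          refine ENNReal.ofReal_le_ofReal ?_
          have e : diagWeight r (c k) (c l) = c k * c l ^ (r - 1) := by
            simp [diagWeight, majorExp, minorExp, h1.le, hr2]
          have e2 : c l ^ r = c l * c l ^ (r - 1) := by
            rw [← Real.rpow_one_add' hl.le (by linarith)]; ring_nf
          rw [e, Real.mul_rpow (by norm_num) hl.le, e2]
          have p1 : 0 < c l ^ (r - 1) := by positivity
          calc (K : ℝ) * (2 ^ r * (c l * c l ^ (r - 1))) =
              2 ^ r * (K * c l) * c l ^ (r - 1) := by ring
            _ ≤ 4 * (2 * c k) * c l ^ (r - 1) := by gcongr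
            _ = _ := by ring

/-- The limit set of a diagonal system has Hausdorff dimension at most `r` if the affinity series
converges at `r`. -/
lemma dimH_limitSet_le {I : Type*} [Countable I] {a b : I → ℝ} (v : I → Plane)
    (ha : ∀ i, a i ≠ 0) (hb : ∀ i, b i ≠ 0) {c : ℝ} (hc0 : 0 ≤ c) (hc : c < 1)
    (hac : ∀ i, |a i| ≤ c) (hbc : ∀ i, |b i| ≤ c) {r : ℝ} (hr : 0 < r) (hr2 : r ≤ 2)
    (hs : affinitySeries (fun i => Matrix.diagonal ![a i, b i]) r < ∞) :
    dimH (limitSet (fun i => affineMap (Matrix.diagonal ![a i, b i]) (v i)) unitSquare) ≤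
      ENNReal.ofReal r := by
  set A := fun i => affineMap (Matrix.diagonal ![a i, b i]) (v i) with hA
  rcases isEmpty_or_nonempty I with hI | ⟨⟨i₀⟩⟩
  · simp [limitSet]
  -- `prefixComp` takes infinite sequences, so finite words are padded by `i₀`; the first `n`
  -- compositions do not see the padding.
  set ext : ∀ n, (Fin n → I) → ℕ → I := fun n u j => if h : j < n then u ⟨j, h⟩ else i₀ with hext
  have prod_ext : ∀ (n : ℕ) (u : Fin n → I) (g : I → ℝ),
      ∏ k ∈ Finset.range n, g (ext n u k) = ∏ j, g (u j) := by
    intro n u g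
    rw [Finset.prod_range]
    simp [hext]
  have cover : ∀ (n : ℕ) (u : Fin (n + 1) → I), ∃ (K : ℕ) (t : Fin K → Set Plane),
      prefixComp A (ext (n + 1) u) (n + 1) '' unitSquare ⊆ ⋃ i, t i ∧
      (∀ i, Metric.ediam (t i) ≤ ENNReal.ofReal (2 * c ^ (n + 1))) ∧
      ∑ i, Metric.ediam (t i) ^ r ≤ 8 * ENNReal.ofReal
        (singularValueFun r (wordProd (fun i => Matrix.diagonal ![a i, b i]) u)) := by
    intro n u
    have ha' : ∏ j, a (u j) ≠ 0 := Finset.prod_ne_zero_iff.2 fun _ _ => ha _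
    have hb' : ∏ j, b (u j) ≠ 0 := Finset.prod_ne_zero_iff.2 fun _ _ => hb _
    have hpow : ∀ g : I → ℝ, (∀ i, |g i| ≤ c) → |∏ j, g (u j)| ≤ c ^ (n + 1) := by
      intro g hg
      rw [Finset.abs_prod]
      exact (Finset.prod_le_prod (fun _ _ => abs_nonneg _) fun j _ => hg (u j)).trans (by simp)
    set d : Fin 2 → ℝ := ![|∏ j, a (u j)|, |∏ j, b (u j)|] with hd
    have hf : ∀ x y j, |prefixComp A (ext (n + 1) u) (n + 1) x j -
        prefixComp A (ext (n + 1) u) (n + 1) y j| = d j * |x j - y j| := by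
      intro x y j
      rw [prefixComp_diagonal_sub, prod_ext (n + 1) u fun i => ![a i, b i] j, abs_mul]
      fin_cases j <;> rfl
    have hdpos : ∀ j, 0 < d j := by
      intro j; fin_cases j
      · exact abs_pos.2 ha'
      · exact abs_pos.2 hb'
    have hdc : ∀ j, d j ≤ c ^ (n + 1) := by
      intro j; fin_cases j
      · exact hpow a hac
      · exact hpow b hbc
    have key : ∀ k l : Fin 2, k ≠ l → d l ≤ d k → ∃ (K : ℕ) (t : Fin K → Set Plane),
        prefixComp A (ext (n + 1) u) (n + 1) '' unitSquare ⊆ ⋃ i, t i ∧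
        (∀ i, Metric.ediam (t i) ≤ ENNReal.ofReal (2 * c ^ (n + 1))) ∧
        ∑ i, Metric.ediam (t i) ^ r ≤ ENNReal.ofReal (8 * diagWeight r (d k) (d l)) := by
      intro k l hkl hle
      obtain ⟨K, t, h1, h2, h3⟩ := exists_cover_cost_le hf hdpos hr hr2 hkl hle
      refine ⟨K, t, h1, fun i => (h2 i).trans (ENNReal.ofReal_le_ofReal ?_), h3⟩
      linarith [hdc k]
    have mono : ∀ x y : ℝ, x ≤ y → ENNReal.ofReal (8 * x) ≤ 8 * ENNReal.ofReal y := by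
      intro x y hxy
      rw [ENNReal.ofReal_mul (by norm_num)]
      simpa using mul_le_mul_right (ENNReal.ofReal_le_ofReal hxy) 8
    rw [wordProd_diagonal, singularValueFun_diagonal hr ha' hb']
    rcases le_total (d 0) (d 1) with h | h
    · obtain ⟨K, t, h1, h2, h3⟩ := key 1 0 (by decide) h
      exact ⟨K, t, h1, h2, h3.trans (mono _ _ (le_max_right _ _))⟩
    · obtain ⟨K, t, h1, h2, h3⟩ := key 0 1 (by decide) h
      exact ⟨K, t, h1, h2, h3.trans (mono _ _ (le_max_left _ _))⟩
  choose K t ht hd hcost using cover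
  have hmeas : MeasureTheory.Measure.hausdorffMeasure r (limitSet A unitSquare) = 0 := by
    refine le_antisymm ?_ zero_le
    refine (MeasureTheory.Measure.hausdorffMeasure_le_liminf_tsum (l := atTop)
      (ι := fun n : ℕ => Σ u : Fin (n + 1) → I, Fin (K n u)) r _
      (fun n => ENNReal.ofReal (2 * c ^ (n + 1))) ?_ (fun n p => t n p.1 p.2)
      (Eventually.of_forall fun n p => hd n p.1 p.2) (Eventually.of_forall fun n => ?_)).trans ?_
    · have h1 : Tendsto (fun n : ℕ => 2 * c ^ (n + 1)) atTop (𝓝 0) := by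
        simpa using ((tendsto_pow_atTop_nhds_zero_of_lt_one hc0 hc).comp
          (tendsto_add_atTop_nat 1)).const_mul 2
      simpa using ENNReal.tendsto_ofReal h1
    · intro x hx
      obtain ⟨ω, hω⟩ := Set.mem_iUnion.1 hx
      have hx1 := Set.mem_iInter.1 hω (n + 1)
      set u : Fin (n + 1) → I := fun j => ω j with hu
      rw [prefixComp_congr A (τ := ext (n + 1) u)
        (fun j hj => by simp [hext, hu, hj])] at hx1
      obtain ⟨i, hi⟩ := Set.mem_iUnion.1 (ht n u hx1)
      exact Set.mem_iUnion.2 ⟨⟨u, i⟩, hi⟩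
    -- The cost at each level is at most `8` times a term of the convergent affinity series.
    · have hlim : Tendsto (fun n : ℕ => 8 * ∑' u : Fin (n + 1) → I, ENNReal.ofReal
          (singularValueFun r (wordProd (fun i => Matrix.diagonal ![a i, b i]) u)))
          atTop (𝓝 0) := by
        have := ENNReal.Tendsto.const_mul (a := 8)
          (ENNReal.tendsto_atTop_zero_of_tsum_ne_top hs.ne) (Or.inr (by simp))
        simpa using this
      rw [← hlim.liminf_eq]
      refine liminf_le_liminf (Eventually.of_forall fun n => ?_)
      rw [ENNReal.tsum_sigma', ← ENNReal.tsum_mul_left]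
      refine ENNReal.tsum_le_tsum fun u => ?_
      rw [tsum_fintype]
      exact hcost n u
  have := dimH_le_of_hausdorffMeasure_ne_top (s := limitSet A unitSquare) (d := r.toNNReal)
    (by rw [Real.coe_toNNReal r hr.le, hmeas]; simp)
  exact this

lemma dimH_limitSet_le_min {I : Type*} [Countable I] {a b : I → ℝ} (v : I → Plane)
    (ha : ∀ i, a i ≠ 0) (hb : ∀ i, b i ≠ 0) {c : ℝ} (hc0 : 0 ≤ c) (hc : c < 1)
    (hac : ∀ i, |a i| ≤ c) (hbc : ∀ i, |b i| ≤ c) :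
    dimH (limitSet (fun i => affineMap (Matrix.diagonal ![a i, b i]) (v i)) unitSquare) ≤
      min 2 (affinityDim fun i => Matrix.diagonal ![a i, b i]) := by
  have h2 : dimH (limitSet (fun i => affineMap (Matrix.diagonal ![a i, b i]) (v i)) unitSquare) ≤
      2 := by
    refine (dimH_mono (Set.subset_univ _)).trans ?_
    rw [Real.dimH_univ_eq_finrank]
    simp
  refine le_min h2 (le_iInf fun r => le_iInf fun hr => le_iInf fun hs => ?_)
  rcases le_total r 2 with hr2 | hr2
  · exact dimH_limitSet_le v ha hb hc0 hc hac hbc hr hr2 hs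
  · refine h2.trans ?_
    rw [show (2 : ℝ≥0∞) = ENNReal.ofReal 2 by simp]
    exact ENNReal.ofReal_le_ofReal hr2

/-! ### Box-counting dimensions -/

section Box

variable {X Y : Type*} [PseudoMetricSpace X] [PseudoMetricSpace Y]

lemma boxCount_le_encard {δ : ℝ} {F : Set X} {C : Set (Set X)} (hF : F ⊆ ⋃₀ C)
    (hC : ∀ U ∈ C, Metric.ediam U ≤ ENNReal.ofReal δ) : boxCount δ F ≤ C.encard :=
  iInf_le_of_le C (iInf_le_of_le hF (iInf_le _ hC))

lemma boxCount_mono {δ : ℝ} {F G : Set X} (h : F ⊆ G) : boxCount δ F ≤ boxCount δ G :=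
  le_iInf fun _ => le_iInf fun hG => le_iInf fun hC => boxCount_le_encard (h.trans hG) hC

lemma one_le_boxCount {δ : ℝ} {F : Set X} (h : F.Nonempty) : 1 ≤ boxCount δ F := by
  refine le_iInf fun C => le_iInf fun hF => le_iInf fun _ => ?_
  rw [Set.one_le_encard_iff_nonempty]
  obtain ⟨x, hx⟩ := h
  obtain ⟨U, hU, _⟩ := hF hx
  exact ⟨U, hU⟩

/-- A cover of the image pulls back to a cover of `F`, with diameters enlarged by at most `κ⁻¹`. -/
lemma boxCount_le_of_antilipschitz {f : X → Y} {κ : ℝ} (hκ : 0 < κ)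
    (hf : ∀ x y, κ * dist x y ≤ dist (f x) (f y)) {δ : ℝ} (F : Set X) :
    boxCount δ F ≤ boxCount (κ * δ) (f '' F) := by
  refine le_iInf fun C => le_iInf fun hF => le_iInf fun hC => ?_
  refine (boxCount_le_encard (C := (fun U => f ⁻¹' U) '' C) ?_ ?_).trans (Set.encard_image_le _ _)
  · intro x hx
    obtain ⟨U, hU, hxU⟩ := hF ⟨x, hx, rfl⟩
    exact ⟨_, ⟨U, hU, rfl⟩, hxU⟩
  · rintro _ ⟨U, hU, rfl⟩
    refine Metric.ediam_le fun x hx y hy => ?_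
    have h1 : edist (f x) (f y) ≤ ENNReal.ofReal (κ * δ) :=
      (Metric.edist_le_ediam_of_mem (show f x ∈ U from hx) (show f y ∈ U from hy)).trans (hC U hU)
    rw [edist_dist, ENNReal.ofReal_le_ofReal_iff'] at h1
    rw [edist_dist]
    rcases h1 with h1 | h1
    · exact ENNReal.ofReal_le_ofReal (le_of_mul_le_mul_left ((hf x y).trans h1) hκ)
    · have : dist x y ≤ 0 := by nlinarith [hf x y, @dist_nonneg _ _ x y]
      rw [ENNReal.ofReal_of_nonpos this]; exact zero_le

lemma eventually_small : ∀ᶠ δ : ℝ in 𝓝[>] 0, 0 < δ ∧ δ < 1 :=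
  Ioo_mem_nhdsGT one_pos

lemma boxRatio_mono {F G : Set X} (h : F ⊆ G) {δ : ℝ} (hδ0 : 0 < δ) (hδ : δ < 1) :
    boxRatio F δ ≤ boxRatio G δ := by
  refine EReal.div_le_div_right_of_nonneg ?_ (ENNReal.log_monotone ?_)
  · exact_mod_cast (neg_pos.2 (Real.log_neg hδ0 hδ)).le
  · exact_mod_cast boxCount_mono h

lemma lowerBoxDim_mono {F G : Set X} (h : F ⊆ G) : lowerBoxDim F ≤ lowerBoxDim G :=
  liminf_le_liminf (eventually_small.mono fun _ hδ => boxRatio_mono h hδ.1 hδ.2)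

lemma lowerBoxDim_le_upperBoxDim (F : Set X) : lowerBoxDim F ≤ upperBoxDim F :=
  liminf_le_limsup

/-- Nonemptiness matters: the empty set has count `0`, whose logarithm is `⊥`. -/
lemma upperBoxDim_nonneg {F : Set X} (h : F.Nonempty) : 0 ≤ upperBoxDim F := by
  refine le_limsup_of_frequently_le (Eventually.frequently ?_)
  filter_upwards [eventually_small] with δ hδ
  refine EReal.div_nonneg ?_ ?_
  · rw [ENNReal.zero_le_log_iff]
    exact_mod_cast one_le_boxCount h
  · exact_mod_cast (neg_pos.2 (Real.log_neg hδ.1 hδ.2)).le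

/-- The constant contributes `log C / (-log δ)`, which tends to `0`. -/
lemma upperBoxDim_le_of_eventually_le {F : Set X} {s C : ℝ} (hC : 0 < C)
    (h : ∀ᶠ δ : ℝ in 𝓝[>] 0, (boxCount δ F : ℝ≥0∞) ≤ ENNReal.ofReal (C * δ ^ (-s))) :
    upperBoxDim F ≤ s := by
  have hlog : Tendsto (fun δ : ℝ => - Real.log δ) (𝓝[>] 0) atTop :=
    tendsto_neg_atBot_atTop.comp Real.tendsto_log_nhdsGT_zero
  have hlim : Tendsto (fun δ : ℝ => Real.log C / (- Real.log δ) + s) (𝓝[>] 0) (𝓝 s) := by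
    simpa using (hlog.const_div_atTop (Real.log C)).add_const s
  have hlim' := (continuous_coe_real_ereal.tendsto s).comp hlim
  rw [← hlim'.limsup_eq]
  refine limsup_le_limsup ?_
  filter_upwards [h, eventually_small] with δ hδ hδ1
  have hl := neg_pos.2 (Real.log_neg hδ1.1 hδ1.2)
  have hpos : 0 < C * δ ^ (-s) := mul_pos hC (Real.rpow_pos_of_pos hδ1.1 _)
  calc boxRatio F δ ≤ (Real.log (C * δ ^ (-s)) : EReal) / ((-Real.log δ : ℝ) : EReal) := by
        refine EReal.div_le_div_right_of_nonneg (by exact_mod_cast hl.le) ?_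
        rw [← ENNReal.log_ofReal_of_pos hpos]
        exact ENNReal.log_monotone hδ
    _ = ((Real.log C / (- Real.log δ) + s : ℝ) : EReal) := by
        rw [← EReal.coe_div, Real.log_mul hC.ne' (Real.rpow_pos_of_pos hδ1.1 _).ne',
          Real.log_rpow hδ1.1]
        congr 1
        have := (neg_pos.1 hl).ne
        field_simp
        ring

lemma eventually_boxCount_le_of_upperBoxDim_lt {F : Set X} {s : ℝ} (h : upperBoxDim F < s) :
    ∀ᶠ δ : ℝ in 𝓝[>] 0, (boxCount δ F : ℝ≥0∞) ≤ ENNReal.ofReal (δ ^ (-s)) := by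
  filter_upwards [eventually_lt_of_limsup_lt h, eventually_small] with δ hδ hδ1
  have hl := neg_pos.2 (Real.log_neg hδ1.1 hδ1.2)
  have hpos : 0 < δ ^ (-s) := Real.rpow_pos_of_pos hδ1.1 _
  rw [boxRatio, EReal.div_lt_iff (by exact_mod_cast hl) (EReal.coe_ne_top _)] at hδ
  rw [← ENNReal.log_le_log_iff, ENNReal.log_ofReal_of_pos hpos, Real.log_rpow hδ1.1]
  refine hδ.le.trans (le_of_eq ?_)
  rw [← EReal.coe_mul]
  congr 1
  ring

/-! ### Packing dimension -/

/-- A set of diameter at most `δ` contains at most one of the separated points. -/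
lemma card_le_boxCount {ι : Type*} {δ : ℝ} {F : Set X} (t : Finset ι) (x : ι → X)
    (hF : ∀ p ∈ t, x p ∈ F) (hsep : ∀ p ∈ t, ∀ q ∈ t, p ≠ q → ENNReal.ofReal δ < edist (x p) (x q)) :
    (t.card : ℕ∞) ≤ boxCount δ F := by
  refine le_iInf fun C => le_iInf fun hC => le_iInf fun hd => ?_
  choose! U hU hxU using fun p (hp : p ∈ t) => hC (hF p hp)
  rw [← Set.encard_coe_eq_coe_finsetCard]
  refine Set.encard_le_encard_of_injOn (f := U) (fun p hp => hU p hp) ?_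
  intro p hp q hq hpq
  by_contra hne
  refine (hsep p hp q hq hne).not_ge (le_trans ?_ (hd _ (hU p hp)))
  exact Metric.edist_le_ediam_of_mem (hxU p hp) (hpq ▸ hxU q hq)

/-- Each packing of a set of small upper box-counting dimension by balls of radius at most `2⁻ᵏ` has
small total cost. -/
lemma packing_sum_le {F : Set X} {s t : ℝ} (ht : 0 < t) {k : ℕ}
    (hN : ∀ n ≥ k, (boxCount ((1 / 2 : ℝ) ^ (n + 1)) F : ℝ≥0∞) ≤
      ENNReal.ofReal (((1 / 2 : ℝ) ^ (n + 1)) ^ (-s))) {T : Finset (X × ℝ)}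
    (hT : IsBallPacking ((1 / 2 : ℝ) ^ k) F T) :
    ∑ p ∈ T, ENNReal.ofReal (2 * p.2) ^ t ≤
      ∑' i : ℕ, ENNReal.ofReal (2 ^ (s + t) * ((1 / 2 : ℝ) ^ (t - s)) ^ (i + k)) := by
  classical
  -- The balls are sorted by dyadic size of the radius. At each scale the centres are separated, so
  -- box counts bound the number of balls.
  have hex : ∀ p ∈ T, ∃ n : ℕ, (1 / 2 : ℝ) ^ (n + k + 1) < p.2 ∧ p.2 ≤ (1 / 2 : ℝ) ^ (n + k) := by
    intro p hp
    obtain ⟨_, h0, h1⟩ := hT.1 p hp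
    have hk : (0 : ℝ) < (1 / 2) ^ k := by positivity
    obtain ⟨n, hn1, hn2⟩ := exists_nat_pow_near_of_lt_one (x := p.2 / (1 / 2 : ℝ) ^ k)
      (y := 1 / 2) (by positivity) ((div_le_one hk).2 h1) (by norm_num) (by norm_num)
    rw [lt_div_iff₀ hk, ← pow_add] at hn1
    rw [div_le_iff₀ hk, ← pow_add] at hn2
    exact ⟨n, by rwa [show n + k + 1 = n + 1 + k by ring], hn2⟩
  choose! n hn1 hn2 using hex
  have hlevel : ∀ i : ℕ, ∑ p ∈ T with n p = i, ENNReal.ofReal (2 * p.2) ^ t ≤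
      ENNReal.ofReal (2 ^ (s + t) * ((1 / 2 : ℝ) ^ (t - s)) ^ (i + k)) := by
    intro i
    have hcard : (((T.filter fun p => n p = i).card : ℕ) : ℝ≥0∞) ≤
        ENNReal.ofReal (((1 / 2 : ℝ) ^ (i + k + 1)) ^ (-s)) := by
      refine le_trans ?_ (hN (i + k) (by omega))
      have := card_le_boxCount (δ := (1 / 2 : ℝ) ^ (i + k + 1)) (F := F)
        (T.filter fun p => n p = i) Prod.fst
        (fun p hp => (hT.1 p (Finset.mem_filter.1 hp).1).1) ?_
      · exact_mod_cast this
      · intro p hp q hq hpq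
        obtain ⟨hp', rfl⟩ := Finset.mem_filter.1 hp
        have hq' := (Finset.mem_filter.1 hq).1
        have hdis := hT.2 hp' hq' hpq
        have hq0 := (hT.1 q hq').2.1
        -- Disjointness keeps `q.1` out of the ball around `p.1`, so the centres are further apart
        -- than `p.2`.
        have : q.1 ∉ Metric.closedBall p.1 p.2 := fun h =>
          Set.disjoint_left.1 hdis h (Metric.mem_closedBall_self hq0.le)
        rw [Metric.mem_closedBall, not_le, dist_comm] at this
        rw [edist_dist]
        have h2 := (hn1 p hp').trans this
        exact (ENNReal.ofReal_lt_ofReal_iff ((by positivity : (0:ℝ) < _).trans h2)).2 h2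
    calc ∑ p ∈ T with n p = i, ENNReal.ofReal (2 * p.2) ^ t
        ≤ ∑ p ∈ T with n p = i, ENNReal.ofReal (2 * (1 / 2 : ℝ) ^ (i + k)) ^ t := by
          refine Finset.sum_le_sum fun p hp => ?_
          obtain ⟨hp', rfl⟩ := Finset.mem_filter.1 hp
          gcongr
          exact hn2 p hp'
      _ = (((T.filter fun p => n p = i).card : ℕ) : ℝ≥0∞) *
            ENNReal.ofReal ((2 * (1 / 2 : ℝ) ^ (i + k)) ^ t) := by
          rw [Finset.sum_const, nsmul_eq_mul, ENNReal.ofReal_rpow_of_pos (by positivity)]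
      _ ≤ ENNReal.ofReal (((1 / 2 : ℝ) ^ (i + k + 1)) ^ (-s)) *
            ENNReal.ofReal ((2 * (1 / 2 : ℝ) ^ (i + k)) ^ t) := by gcongr
      _ = _ := by
          rw [← ENNReal.ofReal_mul (by positivity)]
          congr 1
          simp only [← Real.rpow_natCast]
          rw [show (1 / 2 : ℝ) = 2 ^ (-1 : ℝ) by rw [Real.rpow_neg_one]; norm_num]
          simp only [← Real.rpow_mul (show (0:ℝ) ≤ 2 by norm_num)]
          rw [show (2 : ℝ) * 2 ^ (-1 * ((i + k : ℕ) : ℝ)) = 2 ^ (1 + -1 * ((i + k : ℕ) : ℝ)) by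
            rw [Real.rpow_add (by norm_num), Real.rpow_one],
            ← Real.rpow_mul (by norm_num), ← Real.rpow_add (by norm_num),
            ← Real.rpow_add (by norm_num)]
          congr 1
          push_cast
          ring
  rw [← Finset.sum_fiberwise_of_maps_to (t := T.image n) (g := n)
    (fun p hp => Finset.mem_image_of_mem n hp)]
  exact (Finset.sum_le_sum fun i _ => hlevel i).trans (ENNReal.sum_le_tsum _)

/-- Packings with radii at most `2⁻ᵏ` cost no more than the tail from `k` of a geometric series of
ratio `2 ^ (-(t - s)) < 1`. -/
lemma packingPremeasure_eq_zero {F : Set X} {s t : ℝ} (ht : 0 < t) (hst : s < t)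
    (h : upperBoxDim F < s) : packingPremeasure t F = 0 := by
  have hq0 : (0 : ℝ) < (1 / 2) ^ (t - s) := by positivity
  have hq1 : (1 / 2 : ℝ) ^ (t - s) < 1 :=
    Real.rpow_lt_one (by norm_num) (by norm_num) (sub_pos.2 hst)
  have hsum : ∑' i : ℕ, ENNReal.ofReal (2 ^ (s + t) * ((1 / 2 : ℝ) ^ (t - s)) ^ i) ≠ ∞ := by
    have := (summable_geometric_of_lt_one hq0.le hq1).mul_left (2 ^ (s + t))
    rw [← ENNReal.ofReal_tsum_of_nonneg (fun _ => by positivity) this]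
    exact ENNReal.ofReal_ne_top
  have htail := ENNReal.tendsto_sum_nat_add _ hsum
  have hpow : Tendsto (fun n : ℕ => (1 / 2 : ℝ) ^ (n + 1)) atTop (𝓝[>] 0) := by
    refine tendsto_nhdsWithin_iff.2 ⟨?_, Eventually.of_forall fun n => by
      simp only [Set.mem_Ioi]; positivity⟩
    exact (tendsto_pow_atTop_nhds_zero_of_lt_one (by norm_num) (by norm_num)).comp
      (tendsto_add_atTop_nat 1)
  obtain ⟨k₀, hk₀⟩ := eventually_atTop.1
    (hpow.eventually (eventually_boxCount_le_of_upperBoxDim_lt h))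
  refine le_antisymm (ge_of_tendsto htail ?_) zero_le
  filter_upwards [eventually_ge_atTop k₀] with k hk
  refine iInf_le_of_le ((1 / 2 : ℝ) ^ k) (iInf_le_of_le (by positivity) ?_)
  exact iSup_le fun T => iSup_le fun hT =>
    packing_sum_le ht (fun n hn => hk₀ n (hk.trans hn)) hT

lemma packingDim_le_upperBoxDim {F : Set X} (hF : F.Nonempty) :
    (packingDim F : EReal) ≤ upperBoxDim F := by
  refine EReal.le_of_forall_lt_iff_le.1 fun t ht => ?_
  obtain ⟨s, hs, hst⟩ := EReal.lt_iff_exists_real_btwn.1 ht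
  have hst' : s < t := by exact_mod_cast hst
  have hs0 : 0 < s := by exact_mod_cast (upperBoxDim_nonneg hF).trans_lt hs
  have h0 := packingPremeasure_eq_zero (hs0.trans hst') hst' hs
  have hm : packingMeasure t F = 0 := by
    refine le_antisymm (iInf_le_of_le (fun _ => F) (iInf_le_of_le ?_ ?_)) zero_le
    · exact Set.subset_iUnion_of_subset 0 subset_rfl
    · simp [h0]
  have : packingDim F ≤ ENNReal.ofReal t :=
    iInf_le_of_le t (iInf_le_of_le (hs0.trans hst').le (iInf_le _ hm))
  calc (packingDim F : EReal) ≤ (ENNReal.ofReal t : EReal) := by exact_mod_cast this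
    _ = t := by
      rw [EReal.coe_ennreal_ofReal, max_eq_left (hs0.trans hst').le]

/-- Packing numbers allow infinite separated sets, whereas ball packings are finite; this bridges
the two. -/
lemma encard_le_of_forall_finset_card_le {α : Type*} {C : Set α} {n : ℕ}
    (h : ∀ S : Finset α, (S : Set α) ⊆ C → S.card ≤ n) : C.encard ≤ n := by
  by_contra! hlt
  obtain ⟨S, hSC, hS⟩ := Set.exists_subset_encard_eq (Order.add_one_le_of_lt hlt)
  have hfin : S.Finite := Set.finite_of_encard_le_coe (k := n + 1) (by exact_mod_cast hS.le)
  have h1 := h hfin.toFinset (by simpa using hSC)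
  rw [hfin.encard_eq_coe_toFinset_card] at hS
  have : hfin.toFinset.card = n + 1 := by exact_mod_cast hS
  omega

/-- A set of finite packing premeasure, together with its closure, has covers of controlled size. -/
lemma exists_boxCount_closure_le {G : Set X} {s : ℝ} (hG : packingPremeasure s G < ∞) :
    ∃ C : ℝ, 0 < C ∧ ∀ᶠ δ : ℝ in 𝓝[>] 0,
      (boxCount δ (closure G) : ℝ≥0∞) ≤ ENNReal.ofReal (C * δ ^ (-s)) := by
  simp only [packingPremeasure, iInf_lt_iff] at hG
  obtain ⟨δ₀, hδ₀, hM⟩ := hG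
  set M := ⨆ (t : Finset (X × ℝ)) (_ : IsBallPacking δ₀ G t),
    ∑ p ∈ t, ENNReal.ofReal (2 * p.2) ^ s with hMdef
  -- Balls of radius `δ / 4` around a `δ / 2`-separated set are disjoint and cost `(δ / 2) ^ s`
  -- each, so there are at most `M * 2 ^ s * δ ^ (-s)` of them. The `+ 1` keeps the constant
  -- positive.
  refine ⟨(M.toReal + 1) * 2 ^ s, by positivity, ?_⟩
  have hsmall : ∀ᶠ δ : ℝ in 𝓝[>] 0, δ ∈ Set.Ioo 0 δ₀ := Ioo_mem_nhdsGT hδ₀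
  filter_upwards [hsmall] with δ hδ
  obtain ⟨hδ, hδ1⟩ := hδ
  set B : ℝ := (M.toReal + 1) * 2 ^ s * δ ^ (-s) with hB
  have hB0 : 0 ≤ B := by positivity
  set ε : ℝ≥0 := (δ / 2).toNNReal with hε
  have hεr : (ε : ℝ) = δ / 2 := Real.coe_toNNReal _ (by positivity)
  have hcard : ∀ S : Finset X, (S : Set X) ⊆ G → Metric.IsSeparated ε (S : Set X) →
      S.card ≤ ⌊B⌋₊ := by
    intro S hSG hS
    refine Nat.le_floor ?_
    have hinj : Function.Injective fun x : X => (x, δ / 4) := fun x y h => (Prod.ext_iff.1 h).1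
    set T : Finset (X × ℝ) := S.map ⟨_, hinj⟩
    have hT : IsBallPacking δ₀ G T := by
      constructor
      · intro p hp
        obtain ⟨x, hx, rfl⟩ := Finset.mem_map.1 hp
        exact ⟨hSG hx, show 0 < δ / 4 by positivity, show δ / 4 ≤ δ₀ by linarith⟩
      · intro p hp q hq hpq
        obtain ⟨x, hx, rfl⟩ := Finset.mem_map.1 hp
        obtain ⟨y, hy, rfl⟩ := Finset.mem_map.1 hq
        have hxy : x ≠ y := fun h => hpq (by rw [h])
        have h1 : (ε : ℝ≥0∞) < edist x y := hS hx hy hxy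
        refine Metric.closedBall_disjoint_closedBall (show δ / 4 + δ / 4 < dist x y from ?_)
        rw [edist_dist, ← ENNReal.ofReal_coe_nnreal, hεr] at h1
        have := (ENNReal.ofReal_lt_ofReal_iff_of_nonneg (by positivity)).1 h1
        linarith
    have hle : ∑ p ∈ T, ENNReal.ofReal (2 * p.2) ^ s ≤ M :=
      le_iSup₂_of_le (f := fun (t : Finset (X × ℝ)) (_ : IsBallPacking δ₀ G t) =>
        ∑ p ∈ t, ENNReal.ofReal (2 * p.2) ^ s) T hT le_rfl
    rw [Finset.sum_map] at hle
    simp only [Function.Embedding.coeFn_mk, Finset.sum_const, nsmul_eq_mul] at hle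
    rw [ENNReal.ofReal_rpow_of_pos (by positivity), ← ENNReal.ofReal_natCast,
      ← ENNReal.ofReal_mul (by positivity), ENNReal.ofReal_le_iff_le_toReal hM.ne,
      show 2 * (δ / 4) = δ / 2 by ring, Real.div_rpow hδ.le (by norm_num)] at hle
    have h2 : (0 : ℝ) < 2 ^ s := by positivity
    have h3 : 0 < δ ^ s := by positivity
    rw [hB, Real.rpow_neg hδ.le, ← div_eq_mul_inv, le_div_iff₀ h3]
    rw [mul_div_assoc', div_le_iff₀ h2] at hle
    nlinarith
  have hpack : Metric.packingNumber ε G ≤ ⌊B⌋₊ :=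
    iSup_le fun C => iSup_le fun hCG => iSup_le fun hC =>
      encard_le_of_forall_finset_card_le fun S hS => hcard S (hS.trans hCG) (hC.mono hS)
  have hne : Metric.packingNumber ε G ≠ ⊤ := ne_top_of_le_ne_top (by simp) hpack
  set S := Metric.maximalSeparatedSet ε G with hSdef
  have hSle : S.encard ≤ ⌊B⌋₊ := (Metric.encard_maximalSeparatedSet hne).trans_le hpack
  have hSfin : S.Finite := Set.finite_of_encard_le_coe hSle
  -- By maximality the balls of radius `δ / 2` cover `G`; a finite union of closed balls is closed,
  -- so it also covers the closure.
  have hcov : closure G ⊆ ⋃₀ ((fun x => Metric.closedBall x (δ / 2)) '' S) := by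
    rw [Set.sUnion_image]
    refine closure_minimal ?_ (hSfin.isClosed_biUnion fun x _ => Metric.isClosed_closedBall)
    intro x hx
    obtain ⟨y, hy, hxy⟩ := Metric.isCover_maximalSeparatedSet hne hx
    refine Set.mem_biUnion hy ?_
    have hxy' : edist x y ≤ ε := hxy
    rw [edist_dist, ← ENNReal.ofReal_coe_nnreal, hεr] at hxy'
    exact (ENNReal.ofReal_le_ofReal_iff (by positivity)).1 hxy'
  have hbox : boxCount δ (closure G) ≤ ⌊B⌋₊ := by
    refine (boxCount_le_encard hcov ?_).trans ((Set.encard_image_le _ _).trans hSle)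
    rintro _ ⟨x, _, rfl⟩
    refine Metric.ediam_le fun y hy z hz => ?_
    rw [edist_dist]
    refine ENNReal.ofReal_le_ofReal ?_
    rw [Metric.mem_closedBall] at hy hz
    linarith [dist_triangle_right y z x]
  calc (boxCount δ (closure G) : ℝ≥0∞) ≤ ((⌊B⌋₊ : ℕ) : ℝ≥0∞) := by
        exact_mod_cast hbox
    _ ≤ ENNReal.ofReal B := by
        rw [← ENNReal.ofReal_natCast]
        exact ENNReal.ofReal_le_ofReal (Nat.floor_le hB0)

/-- If the image of `F` under a map contracting distances by at most a fixed factor lies in the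
closure of a set of finite packing premeasure,
then the upper box-counting dimension of `F` is bounded accordingly. -/
lemma upperBoxDim_le_of_image_subset_closure {F : Set X} {G : Set Y} {f : X → Y} {κ : ℝ}
    (hκ : 0 < κ) (hf : ∀ x y, κ * dist x y ≤ dist (f x) (f y)) (hFG : f '' F ⊆ closure G) {s : ℝ}
    (hG : packingPremeasure s G < ∞) : upperBoxDim F ≤ s := by
  obtain ⟨C, hC, hev⟩ := exists_boxCount_closure_le hG
  refine upperBoxDim_le_of_eventually_le (C := C * κ ^ (-s)) (by positivity) ?_
  have hlim : Tendsto (fun δ : ℝ => κ * δ) (𝓝[>] 0) (𝓝[>] 0) := by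
    refine tendsto_nhdsWithin_iff.2 ⟨?_, ?_⟩
    · have : Tendsto (fun δ : ℝ => κ * δ) (𝓝 0) (𝓝 (κ * 0)) := tendsto_id.const_mul κ
      rw [mul_zero] at this
      exact this.mono_left nhdsWithin_le_nhds
    · exact eventually_small.mono fun δ hδ => mul_pos hκ hδ.1
  filter_upwards [hlim.eventually hev, eventually_small] with δ hδ hδ1
  have h1 : boxCount δ F ≤ boxCount (κ * δ) (closure G) :=
    (boxCount_le_of_antilipschitz hκ hf F).trans (boxCount_mono hFG)
  calc (boxCount δ F : ℝ≥0∞) ≤ (boxCount (κ * δ) (closure G) : ℝ≥0∞) := by exact_mod_cast h1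
    _ ≤ _ := hδ
    _ = _ := by rw [Real.mul_rpow hκ.le hδ1.1.le, mul_assoc]

end Box

/-! ### The coding map -/

lemma continuous_prefixComp {ι X : Type*} [TopologicalSpace X] {φ : ι → X → X}
    (h : ∀ i, Continuous (φ i)) (ω : ℕ → ι) (n : ℕ) : Continuous (prefixComp φ ω n) := by
  induction n with
  | zero => exact continuous_id
  | succ n ih => exact ih.comp (h _)

lemma nonempty_iInter_prefixComp {ι X : Type*} [TopologicalSpace X] [T2Space X] {φ : ι → X → X}
    (h : ∀ i, Continuous (φ i)) {K : Set X} (hK : IsCompact K) (hne : K.Nonempty)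
    (hm : ∀ i, Set.MapsTo (φ i) K K) (ω : ℕ → ι) : (⋂ n, prefixComp φ ω n '' K).Nonempty := by
  have hc : ∀ n, IsCompact (prefixComp φ ω n '' K) := fun n => hK.image (continuous_prefixComp h ω n)
  exact IsCompact.nonempty_iInter_of_sequence_nonempty_isCompact_isClosed _
    (fun n => antitone_prefixComp_image hm ω n.le_succ) (fun n => hne.image _) (hc 0)
    (fun n => (hc n).isClosed)

/-- For an infinite iterated function system whose compositions contract uniformly on `K` and expand
distances by at least some positive factor, the upper box-counting dimension of the limit set is at
most its packing dimension. -/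
lemma upperBoxDim_limitSet_le_packingDim {ι X : Type*} [Countable ι] [Nonempty ι] [MetricSpace X]
    {φ : ι → X → X} (hcont : ∀ i, Continuous (φ i)) {K : Set X} (hK : IsCompact K)
    (hne : K.Nonempty) (hm : ∀ i, Set.MapsTo (φ i) K K) {e : ℕ → ℝ} (he : Tendsto e atTop (𝓝 0))
    (hcontr : ∀ ω n, ∀ x ∈ K, ∀ y ∈ K, dist (prefixComp φ ω n x) (prefixComp φ ω n y) ≤ e n)
    (hexp : ∀ ω n, ∃ κ > 0, ∀ x y, κ * dist x y ≤ dist (prefixComp φ ω n x) (prefixComp φ ω n y)) :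
    upperBoxDim (limitSet φ K) ≤ (packingDim (limitSet φ K) : EReal) := by
  -- With the discrete uniformity on `ι`, the code space `ℕ → ι` is complete with countably
  -- generated uniformity, hence a Baire space.
  let : UniformSpace ι := ⊥
  have : DiscreteUniformity ι := ⟨rfl⟩
  choose π hπ using nonempty_iInter_prefixComp hcont hK hne hm
  have huniq : ∀ ω x, (∀ n, x ∈ prefixComp φ ω n '' K) → x = π ω := by
    intro ω x hx
    refine dist_le_zero.1 (ge_of_tendsto he (Eventually.of_forall fun n => ?_))
    obtain ⟨y, hy, hyx⟩ := hx n
    obtain ⟨z, hz, hzx⟩ := Set.mem_iInter.1 (hπ ω) n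
    rw [← hyx, ← hzx]
    exact hcontr ω n y hy z hz
  have hπcont : Continuous π := by
    refine Metric.continuous_iff'.2 fun ω ε hε => ?_
    obtain ⟨n, hn⟩ := (he.eventually_lt_const hε).exists
    have hnhds : {τ : ℕ → ι | ∀ j ∈ Set.Iio n, τ j ∈ ({ω j} : Set ι)} ∈ 𝓝 ω :=
      set_pi_mem_nhds (Set.finite_Iio n) fun j _ => (isOpen_discrete _).mem_nhds rfl
    filter_upwards [hnhds] with τ hτ
    obtain ⟨y, hy, hyx⟩ := Set.mem_iInter.1 (hπ τ) n
    obtain ⟨z, hz, hzx⟩ := Set.mem_iInter.1 (hπ ω) n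
    rw [prefixComp_congr φ (τ := ω) (fun j hj => hτ j hj)] at hyx
    rw [← hyx, ← hzx]
    exact (hcontr ω n y hy z hz).trans_lt hn
  have hmem : ∀ ω, π ω ∈ limitSet φ K := fun ω => Set.mem_iUnion.2 ⟨ω, hπ ω⟩
  have key : ∀ s : ℝ, 0 ≤ s → packingMeasure s (limitSet φ K) = 0 →
      upperBoxDim (limitSet φ K) ≤ s := by
    intro s _ h0
    have hlt : packingMeasure s (limitSet φ K) < ∞ := by rw [h0]; exact ENNReal.zero_lt_top
    simp only [packingMeasure, iInf_lt_iff] at hlt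
    obtain ⟨G, hG, hsum⟩ := hlt
    have hGfin : ∀ n, packingPremeasure s (G n) < ∞ :=
      fun n => lt_of_le_of_lt (ENNReal.le_tsum n) hsum
    have hcover : ⋃ n, π ⁻¹' closure (G n) = Set.univ := by
      refine Set.eq_univ_of_forall fun ω => ?_
      obtain ⟨n, hn⟩ := Set.mem_iUnion.1 (hG (hmem ω))
      exact Set.mem_iUnion.2 ⟨n, subset_closure hn⟩
    obtain ⟨n, ω, hω⟩ := nonempty_interior_of_iUnion_of_closed
      (fun n => isClosed_closure.preimage hπcont) hcover
    -- A neighbourhood in the product topology restricts only finitely many letters, so it contains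
    -- a cylinder around `ω`.
    obtain ⟨m, hcyl⟩ : ∃ m : ℕ, ∀ τ : ℕ → ι, (∀ j < m, τ j = ω j) → π τ ∈ closure (G n) := by
      rw [mem_interior_iff_mem_nhds, nhds_pi, Filter.mem_pi] at hω
      obtain ⟨I, hI, t, ht, hsub⟩ := hω
      obtain ⟨m, hm⟩ := hI.bddAbove
      refine ⟨m + 1, fun τ hτ => hsub fun j hj => ?_⟩
      rw [hτ j (Nat.lt_succ_of_le (hm hj))]
      exact mem_of_mem_nhds (ht j)
    obtain ⟨κ, hκ, hκd⟩ := hexp ω m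
    refine upperBoxDim_le_of_image_subset_closure hκ hκd (G := G n) ?_ (hGfin n)
    rintro _ ⟨x, hx, rfl⟩
    obtain ⟨τ, hτ⟩ := Set.mem_iUnion.1 hx
    -- Prepending the first `m` letters of `ω` to a code of `x` gives a code of the image of `x`,
    -- and this code lies in the cylinder.
    set σ : ℕ → ι := fun j => if j < m then ω j else τ (j - m) with hσ
    have hσω : prefixComp φ σ m = prefixComp φ ω m :=
      prefixComp_congr φ fun j hj => by simp [hσ, hj]
    have hσx : prefixComp φ ω m x = π σ := by
      refine huniq σ _ fun k => ?_
      -- The images are nested, so level `m + k` suffices, where the composition splits after the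
      -- first `m` maps.
      refine antitone_prefixComp_image hm σ (Nat.le_add_left k m) ?_
      simp only [prefixComp_add, hσω]
      rw [Set.image_comp]
      refine Set.mem_image_of_mem _ ?_
      have : (fun j => σ (m + j)) = τ := by ext j; simp [hσ]
      rw [this]
      exact Set.mem_iInter.1 hτ k
    rw [hσx]
    exact hcyl σ fun j hj => by simp [hσ, hj]
  refine EReal.le_of_forall_lt_iff_le.1 fun t ht => ?_
  have ht0 : (0 : EReal) < t := lt_of_le_of_lt (EReal.coe_ennreal_nonneg _) ht
  have ht0' : 0 ≤ t := by exact_mod_cast ht0.le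
  have hlt : packingDim (limitSet φ K) < ENNReal.ofReal t := by
    rw [← EReal.coe_ennreal_lt_coe_ennreal_iff, EReal.coe_ennreal_ofReal, max_eq_left ht0']
    exact ht
  simp only [packingDim, iInf_lt_iff] at hlt
  obtain ⟨s, hs0, hs, hst⟩ := hlt
  refine (key s hs0 hs).trans ?_
  exact_mod_cast ((ENNReal.ofReal_lt_ofReal_iff_of_nonneg hs0).1 hst).le

/-- A map scaling the coordinates by factors of size at least `κ` scales distances by at least `κ`. -/
lemma mul_dist_le_of_coord {f : Plane → Plane} {d : Fin 2 → ℝ} {κ : ℝ} (hκ : 0 ≤ κ)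
    (hκd : ∀ j, κ ≤ |d j|) {x y : Plane} (hf : ∀ j, f x j - f y j = d j * (x j - y j)) :
    κ * dist x y ≤ dist (f x) (f y) := by
  rw [EuclideanSpace.dist_eq, EuclideanSpace.dist_eq, ← Real.sqrt_sq hκ,
    ← Real.sqrt_mul (sq_nonneg κ), Finset.mul_sum]
  refine Real.sqrt_le_sqrt (Finset.sum_le_sum fun j _ => ?_)
  rw [Real.dist_eq, Real.dist_eq, hf, abs_mul, mul_pow]
  gcongr
  exact hκd j

end AffineIFS

/-! ### The main theorem -/

theorem mainTheorem4 {I : Type*} [Countable I] [Infinite I]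
    (a b : I → ℝ) (v : I → Plane)
    (L : I → Matrix (Fin 2) (Fin 2) ℝ) (hL : ∀ i, L i = Matrix.diagonal ![a i, b i])
    (ha : ∀ i, |a i| ∈ Set.Ioo (0 : ℝ) 1) (hb : ∀ i, |b i| ∈ Set.Ioo (0 : ℝ) 1)
    (hsup : ⨆ i, max |a i| |b i| < 1)
    (A : I → Plane → Plane) (hA : ∀ i, A i = AffineIFS.affineMap (L i) (v i))
    (hmaps : ∀ i, Set.MapsTo (A i) AffineIFS.unitSquare AffineIFS.unitSquare)
    (F : Set Plane) (hF : F = AffineIFS.limitSet A AffineIFS.unitSquare) :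
    dimH F ≤ min 2 (AffineIFS.affinityDim L) ∧
    ((∃ I₁ : Finset I, ∀ I₂ : Finset I, I₁ ⊆ I₂ →
        AffineIFS.HasBoxDim
          (AffineIFS.limitSet (fun i : I₂ => A i) AffineIFS.unitSquare)
          (AffineIFS.affinityDim (fun i : I₂ => L i) : EReal)) →
      (AffineIFS.affinityDim L : EReal) ≤ AffineIFS.lowerBoxDim F ∧
      AffineIFS.lowerBoxDim F ≤ AffineIFS.upperBoxDim F ∧
      AffineIFS.upperBoxDim F = (AffineIFS.packingDim F : EReal)) := by
  obtain rfl : L = fun i => Matrix.diagonal ![a i, b i] := funext hL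
  obtain rfl : A = fun i => AffineIFS.affineMap (Matrix.diagonal ![a i, b i]) (v i) := funext hA
  subst hF
  have ha0 : ∀ i, a i ≠ 0 := fun i => abs_pos.1 (ha i).1
  have hb0 : ∀ i, b i ≠ 0 := fun i => abs_pos.1 (hb i).1
  have hbdd : BddAbove (Set.range fun i => max |a i| |b i|) :=
    ⟨1, by rintro _ ⟨i, rfl⟩; exact max_le (ha i).2.le (hb i).2.le⟩
  set c := ⨆ i, max |a i| |b i| with hc
  have hac : ∀ i, |a i| ≤ c := fun i => (le_max_left _ _).trans (le_ciSup hbdd i)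
  have hbc : ∀ i, |b i| ≤ c := fun i => (le_max_right _ _).trans (le_ciSup hbdd i)
  obtain ⟨i₀⟩ : Nonempty I := inferInstance
  have hc0 : 0 < c := (ha i₀).1.trans_le (hac i₀)
  refine ⟨AffineIFS.dimH_limitSet_le_min v ha0 hb0 hc0.le hsup hac hbc, ?_⟩
  rintro ⟨I₁, hI₁⟩
  set F := AffineIFS.limitSet
    (fun i => AffineIFS.affineMap (Matrix.diagonal ![a i, b i]) (v i)) AffineIFS.unitSquare with hF
  have hcont : ∀ i, Continuous (AffineIFS.affineMap (Matrix.diagonal ![a i, b i]) (v i)) :=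
    fun i => AffineIFS.continuous_affineMap _ _
  refine ⟨?_, AffineIFS.lowerBoxDim_le_upperBoxDim F, le_antisymm ?_ ?_⟩
  · have hsub : ∀ I₂ : Finset I, I₁ ⊆ I₂ → ((AffineIFS.affinityDim fun i : I₂ =>
        Matrix.diagonal ![a i, b i] : ℝ≥0∞) : EReal) ≤ AffineIFS.lowerBoxDim F := by
      intro I₂ h
      rw [← (hI₁ I₂ h).1]
      exact AffineIFS.lowerBoxDim_mono (AffineIFS.limitSet_comp_subset
        (fun i => AffineIFS.affineMap (Matrix.diagonal ![a i, b i]) (v i))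
        (fun i : I₂ => (i : I)) AffineIFS.unitSquare)
    -- Nonnegativity lets the lower box dimension be read in `ℝ≥0∞`, where the comparison of
    -- affinity dimensions takes place.
    have hnn : 0 ≤ AffineIFS.lowerBoxDim F :=
      (EReal.coe_ennreal_nonneg _).trans (hsub I₁ subset_rfl)
    rw [← EReal.coe_toENNReal hnn, EReal.coe_ennreal_le_coe_ennreal_iff]
    refine AffineIFS.affinityDim_le_of_finite_subsystems ha0 hb0 hc0 hsup hac hbc I₁
      fun I₂ h => ?_
    rw [← EReal.coe_ennreal_le_coe_ennreal_iff, EReal.coe_toENNReal hnn]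
    exact hsub I₂ h
  · have hprod : ∀ (ω : ℕ → I) (n : ℕ) (j : Fin 2),
        0 < |∏ k ∈ Finset.range n, ![a (ω k), b (ω k)] j| ∧
        |∏ k ∈ Finset.range n, ![a (ω k), b (ω k)] j| ≤ c ^ n := by
      intro ω n j
      rw [Finset.abs_prod]
      have hj : ∀ i, 0 < |![a i, b i] j| ∧ |![a i, b i] j| ≤ c := by
        intro i
        fin_cases j
        · exact ⟨(ha i).1, hac i⟩
        · exact ⟨(hb i).1, hbc i⟩
      refine ⟨Finset.prod_pos fun k _ => (hj _).1, ?_⟩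
      exact (Finset.prod_le_prod (fun _ _ => abs_nonneg _) fun k _ => (hj (ω k)).2).trans (by simp)
    refine AffineIFS.upperBoxDim_limitSet_le_packingDim hcont AffineIFS.isCompact_unitSquare
      AffineIFS.unitSquare_nonempty hmaps (e := fun n => 2 * c ^ n) ?_ ?_ ?_
    · simpa using (tendsto_pow_atTop_nhds_zero_of_lt_one hc0.le hsup).const_mul 2
    · intro ω n x hx y hy
      rw [← ENNReal.ofReal_le_ofReal_iff (by positivity), ← edist_dist]
      refine AffineIFS.edist_le_of_coord fun j => ?_
      rw [AffineIFS.prefixComp_diagonal_sub (c := fun i => ![a i, b i]), abs_mul]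
      calc _ ≤ c ^ n * 1 := mul_le_mul (hprod ω n j).2
            (AffineIFS.abs_sub_le_one_of_mem_unitSquare hx hy j) (abs_nonneg _) (by positivity)
        _ = c ^ n := mul_one _
    · intro ω n
      set d : Fin 2 → ℝ := fun j => ∏ k ∈ Finset.range n, ![a (ω k), b (ω k)] j with hd
      -- The expansion factor depends on the word and has no uniform lower bound over an infinite
      -- alphabet in general; one factor for each word is enough.
      refine ⟨min |d 0| |d 1|, lt_min (hprod ω n 0).1 (hprod ω n 1).1, fun x y => ?_⟩
      refine AffineIFS.mul_dist_le_of_coord (d := d) (by positivity) ?_ fun j =>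
        AffineIFS.prefixComp_diagonal_sub (c := fun i => ![a i, b i]) ω n x y j
      intro j
      fin_cases j
      · exact min_le_left _ _
      · exact min_le_right _ _
  · refine AffineIFS.packingDim_le_upperBoxDim ?_
    obtain ⟨x, hx⟩ := AffineIFS.nonempty_iInter_prefixComp hcont AffineIFS.isCompact_unitSquare
      AffineIFS.unitSquare_nonempty hmaps fun _ => i₀
    exact ⟨x, Set.mem_iUnion.2 ⟨_, hx⟩⟩
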